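/- Let $n\in\mathbb N$, $M>0$ and $R\in\mathbb R$, and write $B_R=\{x\in\mathbb{R}^n:|x|<R\}$. A domain (nonempty connected open set) $\Omega\subset\mathbb{R}^n$ is called $M$-uniform if for all $x_1,x_2\in\overline{\Omega}$ there is a rectifiable curve $\gamma:[0,1]\to\overline{\Omega}$ with $\gamma(0)=x_1$, $\gamma(1)=x_2$ such that (i) $\mathscr{H}^1(\gamma([0,1]))\le M|x_1-x_2|$, and (ii) $d(\gamma(t),\partial\Omega)\ge \frac1M\min\{|\gamma(t)-x_1|,|\gamma(t)-x_2|\}$ for all $t\in[0,1]$. Theorem 1.1. Let $(\Omega_i)_{i\in\mathbb N}$ be a sequence of $M$-uniform domains contained in $B_R$ such that $\inf_i \operatorname{diam}(\Omega_i)>0$. Then there exist an $M$-uniform domain $\Omega\subset B_R$ and a subsequence $(\Omega_{i_k})_k$ such that $\Omega_{i_k}\to\Omega$ in $L^1$ as $k\to\infty$, that is, $\|\chi_{\Omega_{i_k}}-\chi_\Omega\|_{L^1(\mathbb{R}^n)}\to0$. -/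

import Mathlib

open MeasureTheory Filter Topology

/-- `Ω ⊆ ℝⁿ` is an `M`-uniform domain: it is a domain (open, connected, nonempty) and any two points
of its closure are joined by a rectifiable curve `γ : [0,1] → closure Ω` such that
`ℋ¹(γ) ≤ M |x₁ - x₂|` and `d(γ(t), ∂Ω) ≥ (1/M) min {|γ(t) - x₁|, |γ(t) - x₂|}` for all `t`.
Here `ℋ¹(γ)` is the one-dimensional Hausdorff measure of the trace of `γ`, a curve is rectifiable if
it has finite length (total variation), and the distance to the empty set is `∞`. -/
def IsUniformDomain {n : ℕ} (M : ℝ) (Ω : Set (EuclideanSpace ℝ (Fin n))) : Prop :=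
  IsOpen Ω ∧ IsConnected Ω ∧
    ∀ x₁ ∈ closure Ω, ∀ x₂ ∈ closure Ω, ∃ γ : Path x₁ x₂,
      (∀ t, γ t ∈ closure Ω) ∧
      BoundedVariationOn γ Set.univ ∧
      Measure.hausdorffMeasure 1 (Set.range γ) ≤ ENNReal.ofReal (M * dist x₁ x₂) ∧
      ∀ t, ENNReal.ofReal (1 / M * min (dist (γ t) x₁) (dist (γ t) x₂)) ≤
        Metric.infEDist (γ t) (frontier Ω)

/-- Convergence of sets in `L¹`: the characteristic functions of `A k` converge to the
characteristic function of `B` in `L¹(ℝⁿ)`. -/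
def TendstoL1 {n : ℕ} (A : ℕ → Set (EuclideanSpace ℝ (Fin n)))
    (B : Set (EuclideanSpace ℝ (Fin n))) : Prop :=
  Tendsto
    (fun k => eLpNorm (fun x => (A k).indicator (fun _ => (1 : ℝ)) x -
      B.indicator (fun _ => (1 : ℝ)) x) 1 volume)
    atTop (𝓝 0)

/-! The functions `d_i = dist(·, Ω_iᶜ)` are 1-Lipschitz and locally bounded, so a subsequence
converges pointwise to some `u`; the limit domain is `{u > 0}`. Condition (ii) yields corkscrew
points: near any closure point, at every small scale `r`, some `y` has `d_i(y) ≥ r / M`. In the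
limit they make `{u > 0}` nonempty and put every point lying in infinitely many `Ω_i` in its
closure. They also make the frontier porous, hence null. Off it, membership in `Ω_i` is eventually
constant, and dominated convergence gives L¹ convergence. Uniformity passes to the limit through
curves. Only the traces have controlled length, so they are replaced by almost Lipschitz step maps
(`exists_step_map_of_hausdorffMeasure_le`), whose ultralimit is a Lipschitz curve
(`exists_limit_path`). -/

theorem exists_isOpen_cover_tsum_ediam_le {X : Type*} [MetricSpace X] [MeasurableSpace X]
    [BorelSpace X] {Γ : Set X} {C : ENNReal} (hC : C ≠ ⊤)
    (hΓ : Measure.hausdorffMeasure 1 Γ ≤ C) {ε : ℝ} (hε : 0 < ε) :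
    ∃ U : ℕ → Set X, (∀ n, IsOpen (U n)) ∧ Γ ⊆ ⋃ n, U n ∧
      (∀ n, Metric.ediam (U n) ≤ ENNReal.ofReal ε) ∧
      ∑' n, Metric.ediam (U n) ≤ C + ENNReal.ofReal ε := by
  -- One half of `ε` pays for the near-optimal cover, the other for thickening it to open sets.
  set η : ENNReal := ENNReal.ofReal (ε / 2) with hη
  have hη0 : 0 < η := ENNReal.ofReal_pos.2 (by linarith)
  have hηη : η + η = ENNReal.ofReal ε := by
    rw [hη, ← ENNReal.ofReal_add (by linarith) (by linarith)]; congr 1; ring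
  rw [Measure.hausdorffMeasure_apply] at hΓ
  have h1 := lt_of_le_of_lt ((le_iSup₂ (f := fun (r : ENNReal) (_ : 0 < r) =>
    ⨅ (t : ℕ → Set X) (_ : Γ ⊆ ⋃ n, t n) (_ : ∀ n, Metric.ediam (t n) ≤ r),
      ∑' n, ⨆ _ : (t n).Nonempty, Metric.ediam (t n) ^ (1 : ℝ)) η hη0).trans hΓ)
    (ENNReal.lt_add_right hC hη0.ne')
  simp only [iInf_lt_iff] at h1
  obtain ⟨t, hcov, hdiam, hsum⟩ := h1
  obtain ⟨δ, hδ0, hδ⟩ := ENNReal.exists_pos_sum_of_countable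
    (ENNReal.half_pos hη0.ne').ne' ℕ
  have hδ2 : ∑' n, 2 * (δ n : ENNReal) ≤ η := by
    rw [ENNReal.tsum_mul_left]
    calc 2 * ∑' n, (δ n : ENNReal) ≤ 2 * (η / 2) := by gcongr
      _ = η := ENNReal.mul_div_cancel two_ne_zero ENNReal.ofNat_ne_top
  have ht : ∀ n, Metric.ediam (t n) = ⨆ _ : (t n).Nonempty, Metric.ediam (t n) ^ (1 : ℝ) := by
    intro n
    rcases (t n).eq_empty_or_nonempty with h | h
    · simp [h]
    · rw [iSup_pos h, ENNReal.rpow_one]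
  have hU : ∀ n, Metric.ediam (Metric.thickening (δ n) (t n)) ≤
      Metric.ediam (t n) + 2 * δ n := fun n => Metric.ediam_thickening_le _
  refine ⟨fun n => Metric.thickening (δ n) (t n), fun n => Metric.isOpen_thickening, ?_, ?_, ?_⟩
  · exact hcov.trans (Set.iUnion_mono fun n =>
      Metric.self_subset_thickening (by exact_mod_cast hδ0 n) _)
  · intro n
    calc _ ≤ _ := hU n
      _ ≤ η + η := add_le_add (hdiam n) ((ENNReal.le_tsum n).trans hδ2)
      _ = _ := hηη
  · calc _ ≤ ∑' n, (Metric.ediam (t n) + 2 * δ n) := ENNReal.tsum_le_tsum hU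
      _ = ∑' n, Metric.ediam (t n) + ∑' n, 2 * (δ n : ENNReal) := ENNReal.tsum_add
      _ ≤ (C + η) + η := by
        refine add_le_add ?_ hδ2
        rw [tsum_congr ht]; exact hsum.le
      _ = _ := by rw [add_assoc, hηη]

/-- The sets of a family are adjacent when they meet inside `Γ`. -/
def coverGraph {X ι : Type*} (Γ : Set X) (U : ι → Set X) : SimpleGraph ι where
  Adj i j := i ≠ j ∧ (Γ ∩ (U i ∩ U j)).Nonempty
  symm := ⟨fun i j h => ⟨h.1.symm, by rw [Set.inter_comm (U j)]; exact h.2⟩⟩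
  loopless := ⟨fun i h => h.1 rfl⟩

/-- Otherwise the sets reachable from `i` and the rest form two open unions; connectedness gives a
point of `Γ` in both, hence an edge between them. -/
theorem coverGraph_reachable {X ι : Type*} [TopologicalSpace X] {Γ : Set X} {U : ι → Set X}
    (hΓ : IsPreconnected Γ) (hU : ∀ i, IsOpen (U i)) (hcov : Γ ⊆ ⋃ i, U i) {i j : ι}
    (hi : (Γ ∩ U i).Nonempty) (hj : (Γ ∩ U j).Nonempty) : (coverGraph Γ U).Reachable i j := by
  by_contra hij
  let S : Set ι := {k | (coverGraph Γ U).Reachable i k}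
  obtain ⟨x, hxΓ, hxA, hxB⟩ := hΓ (⋃ k ∈ S, U k) (⋃ k ∈ Sᶜ, U k)
    (isOpen_biUnion fun k _ => hU k) (isOpen_biUnion fun k _ => hU k)
    (by
      intro x hx
      obtain ⟨k, hk⟩ := Set.mem_iUnion.1 (hcov hx)
      by_cases hkS : k ∈ S
      · exact Or.inl (Set.mem_biUnion hkS hk)
      · exact Or.inr (Set.mem_biUnion hkS hk))
    (hi.mono (Set.inter_subset_inter_right _
      (Set.subset_biUnion_of_mem (u := U) (SimpleGraph.Reachable.refl i : i ∈ S))))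
    (hj.mono (Set.inter_subset_inter_right _ (Set.subset_biUnion_of_mem (u := U) (hij : j ∈ Sᶜ))))
  obtain ⟨k, hk, hxk⟩ := Set.mem_iUnion₂.1 hxA
  obtain ⟨l, hl, hxl⟩ := Set.mem_iUnion₂.1 hxB
  refine hl (SimpleGraph.Reachable.trans hk (SimpleGraph.Adj.reachable ⟨?_, x, hxΓ, hxk, hxl⟩))
  rintro rfl
  exact hl hk

/-- The map waits at each point for a time equal to the length of its next jump. The last clause,
free of `ε`, keeps errors from accumulating in the induction. -/
theorem coverGraph_walk_step_map {X ι : Type*} [MetricSpace X] {Γ : Set X} {U : ι → Set X}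
    {ε : ℝ} (hε : 0 ≤ ε) (hdiam : ∀ i, Metric.ediam (U i) ≤ ENNReal.ofReal ε) {i j : ι}
    (p : (coverGraph Γ U).Walk i j) {x y : X} (hx : x ∈ Γ ∩ U i) (hy : y ∈ Γ ∩ U j) :
    ∃ T : ℝ, 0 ≤ T ∧ ENNReal.ofReal T ≤ (p.support.map fun k => Metric.ediam (U k)).sum ∧
      ∃ g : ℝ → X, g 0 = x ∧ g T = y ∧ (∀ t, g t ∈ Γ) ∧
        (∀ s t, 0 ≤ s → s ≤ t → dist (g s) (g t) ≤ t - s + ε) ∧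
        ∀ t, 0 ≤ t → dist (g 0) (g t) ≤ t := by
  have hdist : ∀ k, ∀ a ∈ U k, ∀ b ∈ U k, dist a b ≤ ε := fun k a ha b hb => by
    rw [← ENNReal.ofReal_le_ofReal_iff hε, ← edist_dist]
    exact (Metric.edist_le_ediam_of_mem ha hb).trans (hdiam k)
  induction p generalizing x with
  | nil =>
    rename_i k
    have hxy := hdist _ x hx.2 y hy.2
    refine ⟨dist x y, dist_nonneg, ?_, fun s => if s < dist x y then x else y, ?_, ?_, ?_, ?_, ?_⟩
    · simpa [← edist_dist] using Metric.edist_le_ediam_of_mem hx.2 hy.2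
    · by_cases h : x = y
      · simp [h]
      · simp [h]
    · simp
    · intro t
      dsimp only
      split_ifs
      exacts [hx.1, hy.1]
    · intro s t hs hst
      dsimp only
      split_ifs <;> (try rw [dist_self]) <;> linarith
    · intro t ht
      dsimp only
      split_ifs <;> (try rw [dist_self]) <;> linarith
  | cons h p ih =>
    rename_i u v w
    obtain ⟨z, hzΓ, hzu, hzv⟩ := h.2
    obtain ⟨T, hT0, hT, g, hg0, hgT, hgΓ, hgA, hgB⟩ := ih ⟨hzΓ, hzv⟩ hy
    have hd : dist x z ≤ ε := hdist _ x hx.2 z hzu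
    have hd0 : 0 ≤ dist x z := dist_nonneg
    have key : ∀ t, dist x z ≤ t → dist x (g (t - dist x z)) ≤ t := fun t ht => by
      have h1 := dist_triangle x z (g (t - dist x z))
      have h2 := hgB (t - dist x z) (by linarith)
      rw [hg0] at h2
      linarith
    refine ⟨dist x z + T, by positivity, ?_,
      fun s => if s < dist x z then x else g (s - dist x z), ?_, ?_, ?_, ?_, ?_⟩
    · rw [ENNReal.ofReal_add hd0 hT0, ← edist_dist]
      rw [SimpleGraph.Walk.support_cons, List.map_cons, List.sum_cons]
      exact add_le_add (Metric.edist_le_ediam_of_mem hx.2 hzu) hT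
    · by_cases h : x = z
      · simp [h, hg0]
      · simp [h]
    · simp [hT0, hgT]
    · intro t
      dsimp only
      split_ifs
      exacts [hx.1, hgΓ _]
    · intro s t hs hst
      dsimp only
      split_ifs with h1 h2 h2
      · simp only [dist_self]; linarith
      · linarith [key t (by linarith)]
      · linarith
      · linarith [hgA (s - dist x z) (t - dist x z) (by linarith) (by linarith)]
    · intro t ht
      have hx0 : (if (0 : ℝ) < dist x z then x else g (0 - dist x z)) = x := by
        by_cases h : x = z
        · simp [h, hg0]
        · simp [h]
      dsimp only
      rw [hx0]
      split_ifs with h1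
      · simpa using ht
      · exact key t (by linarith)

/-- Two points of a connected set of finite length are joined, within the set, by a step map that is
Lipschitz up to an error `ε`, with constant the length up to `ε`. -/
theorem exists_step_map_of_hausdorffMeasure_le {X : Type*} [MetricSpace X] [MeasurableSpace X]
    [BorelSpace X] {Γ : Set X} (hΓ : IsPreconnected Γ) {L : ℝ} (hL : 0 ≤ L)
    (hH : Measure.hausdorffMeasure 1 Γ ≤ ENNReal.ofReal L) {x y : X} (hx : x ∈ Γ) (hy : y ∈ Γ)
    {ε : ℝ} (hε : 0 < ε) :
    ∃ g : ℝ → X, g 0 = x ∧ g 1 = y ∧ (∀ t, g t ∈ Γ) ∧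
      ∀ s t, 0 ≤ s → s ≤ t → dist (g s) (g t) ≤ (L + ε) * (t - s) + ε := by
  classical
  obtain ⟨U, hUo, hcov, hdiam, hsum⟩ :=
    exists_isOpen_cover_tsum_ediam_le ENNReal.ofReal_ne_top hH hε
  obtain ⟨i, hi⟩ := Set.mem_iUnion.1 (hcov hx)
  obtain ⟨j, hj⟩ := Set.mem_iUnion.1 (hcov hy)
  obtain ⟨p⟩ := coverGraph_reachable hΓ hUo hcov ⟨x, hx, hi⟩ ⟨y, hy, hj⟩
  obtain ⟨T, hT0, hT, g, hg0, hgT, hgΓ, hg, -⟩ :=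
    -- A path visits each set at most once, so its diameters sum to at most the full series.
    coverGraph_walk_step_map hε.le hdiam (p.toPath : (coverGraph Γ U).Walk i j) ⟨hx, hi⟩ ⟨hy, hj⟩
  have hTL : T ≤ L + ε := by
    rw [← ENNReal.ofReal_le_ofReal_iff (by positivity), ENNReal.ofReal_add hL hε.le]
    refine hT.trans (le_trans ?_ hsum)
    rw [← List.sum_toFinset _ p.toPath.2.support_nodup]
    exact ENNReal.sum_le_tsum _
  refine ⟨fun s => g (T * s), by simpa using hg0, by simpa using hgT, fun t => hgΓ _, ?_⟩
  intro s t hs hst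
  refine (hg (T * s) (T * t) (by positivity) (by gcongr)).trans ?_
  nlinarith [mul_le_mul_of_nonneg_right hTL (sub_nonneg.2 hst)]

/-! ### Ultralimits of step maps and Lipschitz paths -/

theorem IsCompact.exists_tendsto_of_ultrafilter {X ι : Type*} [TopologicalSpace X] {K : Set X}
    (hK : IsCompact K) (U : Ultrafilter ι) {f : ι → X} (hf : ∀ i, f i ∈ K) :
    ∃ x ∈ K, Tendsto f U (𝓝 x) :=
  hK.ultrafilter_le_nhds' (U.map f) (Ultrafilter.mem_map.2 (Filter.univ_mem' hf))

theorem exists_lipschitzOnWith_ultrafilter_limit {X : Type*} [MetricSpace X] {K : Set X}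
    (hK : IsCompact K) (U : Ultrafilter ℕ) {g : ℕ → ℝ → X} (hg : ∀ i t, g i t ∈ K)
    {T ε : ℕ → ℝ} {L : ℝ} (hT : Tendsto T U (𝓝 L)) (hε : Tendsto ε U (𝓝 0))
    (h : ∀ i s t, 0 ≤ s → s ≤ t → dist (g i s) (g i t) ≤ T i * (t - s) + ε i) :
    ∃ γ : ℝ → X, LipschitzOnWith L.toNNReal γ (Set.Icc 0 1) ∧
      ∀ t, Tendsto (fun i => g i t) U (𝓝 (γ t)) := by
  choose γ _ hγ using fun t => hK.exists_tendsto_of_ultrafilter U (fun i => hg i t)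
  have key : ∀ s t, 0 ≤ s → s ≤ t → dist (γ s) (γ t) ≤ L * (t - s) := fun s t hs hst => by
    have := le_of_tendsto_of_tendsto ((hγ s).dist (hγ t))
      ((hT.mul_const (t - s)).add hε) (Eventually.of_forall fun i => h i s t hs hst)
    simpa using this
  refine ⟨γ, LipschitzOnWith.of_dist_le_mul fun s hs t ht => ?_, hγ⟩
  rcases le_total s t with hst | hst
  · rw [dist_comm s t, Real.dist_eq, abs_of_nonneg (sub_nonneg.2 hst)]
    exact (key s t hs.1 hst).trans
      (mul_le_mul_of_nonneg_right (Real.le_coe_toNNReal L) (sub_nonneg.2 hst))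
  · rw [dist_comm (γ s), Real.dist_eq, abs_of_nonneg (sub_nonneg.2 hst)]
    exact (key t s ht.1 hst).trans
      (mul_le_mul_of_nonneg_right (Real.le_coe_toNNReal L) (sub_nonneg.2 hst))

theorem exists_path_of_lipschitzOnWith {X : Type*} [MetricSpace X] [MeasurableSpace X]
    [BorelSpace X] {γ : ℝ → X} {L : NNReal} (hγ : LipschitzOnWith L γ (Set.Icc 0 1)) {x y : X}
    (hx : γ 0 = x) (hy : γ 1 = y) :
    ∃ p : Path x y, (∀ t : unitInterval, p t = γ t) ∧ BoundedVariationOn p Set.univ ∧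
      Measure.hausdorffMeasure 1 (Set.range p) ≤ L := by
  let p : Path x y :=
    { toFun := fun t => γ t
      continuous_toFun := continuousOn_iff_continuous_domRestrict.1 hγ.continuousOn
      source' := by simpa using hx
      target' := by simpa using hy }
  have hp : ∀ t : unitInterval, p t = γ t := fun t => rfl
  refine ⟨p, hp, ?_, ?_⟩
  · have h1 : eVariationOn p Set.univ ≤ eVariationOn γ (Set.Icc 0 1) :=
      eVariationOn.comp_le_of_monotoneOn γ (fun t : unitInterval => (t : ℝ))
        (fun a _ b _ hab => hab) fun t _ => t.2
    have h2 := hγ.locallyBoundedVariationOn 0 1 (by simp) (by simp)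
    rw [Set.inter_self] at h2
    exact ne_top_of_le_ne_top h2 h1
  · have h1 : Set.range p ⊆ γ '' Set.Icc 0 1 := by
      rintro _ ⟨t, rfl⟩
      exact ⟨t, t.2, rfl⟩
    refine (measure_mono h1).trans ((hγ.hausdorffMeasure_image_le zero_le_one).trans ?_)
    simp [hausdorffMeasure_real]

/-! ### Distance to the complement, corkscrews and null frontiers -/

theorem IsOpen.inter_frontier_nonempty_of_isPreconnected {X : Type*} [TopologicalSpace X]
    {s t : Set X} (hs : IsOpen s) (ht : IsPreconnected t) (h : (t ∩ s).Nonempty)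
    (h' : (t ∩ sᶜ).Nonempty) : (t ∩ frontier s).Nonempty := by
  by_contra hf
  have hf' : ∀ x ∈ t, x ∈ closure s → x ∈ s := fun x hx hxc => by
    by_contra hxs
    exact hf ⟨x, hx, by rw [hs.frontier_eq]; exact ⟨hxc, hxs⟩⟩
  obtain ⟨x, hx, hxs, hxc⟩ := ht s (closure s)ᶜ hs isClosed_closure.isOpen_compl
    (fun x hx => or_iff_not_imp_right.2 fun h => hf' x hx (not_not.1 h)) h
    (h'.imp fun x hx => ⟨hx.1, fun hxc => hx.2 (hf' x hx.1 hxc)⟩)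
  exact hxc (subset_closure hxs)

theorem infEDist_frontier_le_infEDist_compl {E : Type*} [NormedAddCommGroup E] [NormedSpace ℝ E]
    {Ω : Set E} (hΩ : IsOpen Ω) {y : E} (hy : y ∈ closure Ω) :
    Metric.infEDist y (frontier Ω) ≤ Metric.infEDist y Ωᶜ := by
  by_cases hyΩ : y ∈ Ω
  · refine Metric.le_infEDist.2 fun z hz => ?_
    obtain ⟨w, hw, hwf⟩ := hΩ.inter_frontier_nonempty_of_isPreconnected
      (convex_segment y z).isPreconnected ⟨y, left_mem_segment ℝ y z, hyΩ⟩
      ⟨z, right_mem_segment ℝ y z, hz⟩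
    refine (Metric.infEDist_le_edist_of_mem hwf).trans ?_
    rw [edist_dist, edist_dist]
    refine ENNReal.ofReal_le_ofReal ?_
    have := dist_add_dist_of_mem_segment hw
    linarith [dist_nonneg (x := w) (y := z)]
  · have : y ∈ frontier Ω := by rw [hΩ.frontier_eq]; exact ⟨hy, hyΩ⟩
    rw [Metric.infEDist_zero_of_mem this]
    exact zero_le

theorem le_infDist_compl_of_le_infEDist_frontier {E : Type*} [NormedAddCommGroup E]
    [NormedSpace ℝ E] {Ω : Set E} (hΩ : IsOpen Ω) (hne : Ωᶜ.Nonempty) {y : E}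
    (hy : y ∈ closure Ω) {s : ℝ}
    (hs : ENNReal.ofReal s ≤ Metric.infEDist y (frontier Ω)) : s ≤ Metric.infDist y Ωᶜ := by
  have := hs.trans (infEDist_frontier_le_infEDist_compl hΩ hy)
  exact (ENNReal.ofReal_le_iff_le_toReal (Metric.infEDist_ne_top hne)).1 this

namespace IsUniformDomain

variable {n : ℕ} {M : ℝ} {Ω : Set (EuclideanSpace ℝ (Fin n))}

/-- Interior corkscrew condition. -/
theorem exists_corkscrew (h : IsUniformDomain M Ω) (hne : Ωᶜ.Nonempty)
    {x z : EuclideanSpace ℝ (Fin n)} (hx : x ∈ closure Ω) (hz : z ∈ closure Ω) {r : ℝ}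
    (hr : 0 ≤ r) (hxz : 2 * r ≤ dist x z) :
    ∃ y ∈ closure Ω, dist y x = r ∧ r / M ≤ Metric.infDist y Ωᶜ := by
  obtain ⟨γ, hγ, -, -, hd⟩ := h.2.2 x hx z hz
  have hcont : Continuous fun t => dist (γ t) x := by fun_prop
  obtain ⟨t, ht⟩ : r ∈ Set.range fun t => dist (γ t) x := by
    refine mem_range_of_exists_le_of_exists_ge hcont ⟨0, by simpa using hr⟩ ⟨1, ?_⟩
    simp only [γ.target]
    rw [dist_comm]
    linarith
  refine ⟨γ t, hγ t, ht, ?_⟩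
  have hmin : min (dist (γ t) x) (dist (γ t) z) = r := by
    simp only at ht
    rw [ht]
    refine min_eq_left ?_
    have := dist_triangle x (γ t) z
    rw [dist_comm x (γ t), ht] at this
    linarith
  refine le_infDist_compl_of_le_infEDist_frontier h.1 hne (hγ t) ?_
  have := hd t
  rwa [hmin, one_div_mul_eq_div] at this

/-- Corkscrew balls shrinking to a frontier point miss the frontier, which contradicts Lebesgue
density there. -/
theorem volume_frontier [Nontrivial (EuclideanSpace ℝ (Fin n))] (h : IsUniformDomain M Ω)
    (hM : 0 < M) (hne : Ωᶜ.Nonempty) : volume (frontier Ω) = 0 := by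
  by_contra h0
  -- The balls are off-centre: radius `r / (2M)`, centre at distance `r` from `x`, hence the factor
  -- `2M`.
  have hae := IsUnifLocDoublingMeasure.ae_tendsto_measure_inter_div volume (frontier Ω) (2 * M)
  have : (ae (volume.restrict (frontier Ω))).NeBot := by
    rw [ae_neBot]
    intro hz
    exact h0 (Measure.restrict_eq_zero.1 hz)
  obtain ⟨x, hx, hxf⟩ := (hae.and
    (ae_restrict_mem isClosed_frontier.measurableSet)).exists
  obtain ⟨z, hz⟩ := h.2.1.nonempty
  have hxz : x ≠ z := by
    rintro rfl
    rw [h.1.frontier_eq] at hxf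
    exact hxf.2 hz
  have hd : 0 < dist x z := dist_pos.2 hxz
  let r : ℕ → ℝ := fun k => dist x z / 2 / (k + 1)
  have hr : ∀ k, 0 < r k := fun k => by positivity
  have hr2 : ∀ k, 2 * r k ≤ dist x z := fun k => by
    have : r k ≤ dist x z / 2 := div_le_self (by positivity) (by simp)
    linarith
  choose y hyc hyx hy using fun k => h.exists_corkscrew hne
    (frontier_subset_closure hxf) (subset_closure hz) (hr k).le (hr2 k)
  have hr0 : Tendsto r atTop (𝓝 0) := by
    have := (tendsto_one_div_add_atTop_nhds_zero_nat (𝕜 := ℝ)).const_mul (dist x z / 2)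
    simpa [r, div_eq_mul_inv] using this
  have hδ : Tendsto (fun k => r k / (2 * M)) atTop (𝓝[>] 0) := by
    refine tendsto_nhdsWithin_iff.2 ⟨by simpa using hr0.div_const (2 * M), ?_⟩
    exact Eventually.of_forall fun k => div_pos (hr k) (by positivity)
  have hlim := hx y (fun k => r k / (2 * M)) hδ (Eventually.of_forall fun k => by
    rw [Metric.mem_closedBall, dist_comm, hyx, mul_div_cancel₀ _ (by positivity)])
  have hempty : ∀ k, frontier Ω ∩ Metric.closedBall (y k) (r k / (2 * M)) = ∅ := fun k => by
    rw [← Set.disjoint_iff_inter_eq_empty, Set.disjoint_left]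
    intro w hw hwb
    rw [h.1.frontier_eq] at hw
    have h1 := (hy k).trans (Metric.infDist_le_dist_of_mem (show w ∈ Ωᶜ from hw.2))
    rw [Metric.mem_closedBall, dist_comm] at hwb
    have h2 : 0 < r k / M := div_pos (hr k) hM
    have h3 : r k / (2 * M) = r k / M / 2 := by field_simp
    linarith
  simp only [hempty, measure_empty, ENNReal.zero_div] at hlim
  exact zero_ne_one (tendsto_nhds_unique tendsto_const_nhds hlim)

end IsUniformDomain

/-! ### Compactness of distance functions -/

theorem exists_subseq_tendsto_of_lipschitz {X : Type*} [PseudoMetricSpace X]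
    [TopologicalSpace.SeparableSpace X] {f : ℕ → X → ℝ} (hf : ∀ i, LipschitzWith 1 (f i))
    {a b : X → ℝ} (hab : ∀ i x, f i x ∈ Set.Icc (a x) (b x)) :
    ∃ (φ : ℕ → ℕ) (u : X → ℝ), StrictMono φ ∧ ∀ x, Tendsto (fun k => f (φ k) x) atTop (𝓝 (u x)) := by
  rcases isEmpty_or_nonempty X with hX | hX
  · exact ⟨id, fun _ => 0, strictMono_id, fun x => (hX.false x).elim⟩
  let q := TopologicalSpace.denseSeq X
  have hK : IsCompact (Set.univ.pi fun j => Set.Icc (a (q j)) (b (q j))) :=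
    isCompact_univ_pi fun j => isCompact_Icc
  obtain ⟨v, -, φ, hφ, hv⟩ := hK.tendsto_subseq (x := fun i j => f i (q j))
    fun i j _ => hab i (q j)
  rw [tendsto_pi_nhds] at hv
  have hc : ∀ x, CauchySeq fun k => f (φ k) x := fun x => by
    refine Metric.cauchySeq_iff'.2 fun ε hε => ?_
    obtain ⟨j, hj⟩ := (TopologicalSpace.denseRange_denseSeq X).exists_dist_lt x
      (show 0 < ε / 3 by positivity)
    obtain ⟨N, hN⟩ := Metric.cauchySeq_iff'.1 (hv j).cauchySeq (ε / 3) (by positivity)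
    refine ⟨N, fun k hk => ?_⟩
    have h1 := (hf (φ k)).dist_le_mul x (q j)
    have h2 := (hf (φ N)).dist_le_mul (q j) x
    have h3 := hN k hk
    rw [dist_comm (q j)] at h2
    simp only [NNReal.coe_one, one_mul] at h1 h2
    have h4 := dist_triangle4 (f (φ k) x) (f (φ k) (q j)) (f (φ N) (q j)) (f (φ N) x)
    simp only [Function.comp_apply] at h3
    linarith
  choose u hu using fun x => cauchySeq_tendsto_of_complete (hc x)
  exact ⟨φ, u, hφ, hu⟩

theorem tendsto_apply_of_lipschitzWith {X ι : Type*} [PseudoMetricSpace X] {l : Filter ι}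
    {f : ι → X → ℝ} {u : X → ℝ} (hf : ∀ i, LipschitzWith 1 (f i)) {x : ι → X} {y : X}
    (hfu : Tendsto (fun i => f i y) l (𝓝 (u y))) (hx : Tendsto x l (𝓝 y)) :
    Tendsto (fun i => f i (x i)) l (𝓝 (u y)) := by
  have hx' : Tendsto (fun i => dist y (x i)) l (𝓝 0) := by
    simpa [dist_comm] using tendsto_iff_dist_tendsto_zero.1 hx
  refine hfu.congr_dist (squeeze_zero (fun _ => dist_nonneg) (fun i => ?_) hx')
  simpa using (hf i).dist_le_mul y (x i)

/-! ### The limit domain -/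

section Limit

variable {n : ℕ} {M R : ℝ} {Ω : ℕ → Set (EuclideanSpace ℝ (Fin n))}
  {u : EuclideanSpace ℝ (Fin n) → ℝ}

theorem eventually_mem_of_limit_infDist_compl_pos {l : Filter ℕ}
    (hu : ∀ x, Tendsto (fun i => Metric.infDist x (Ω i)ᶜ) l (𝓝 (u x)))
    {x : EuclideanSpace ℝ (Fin n)} (hx : 0 < u x) : ∀ᶠ i in l, x ∈ Ω i := by
  filter_upwards [(hu x).eventually_const_lt hx] with i hi
  by_contra h
  rw [Metric.infDist_zero_of_mem (show x ∈ (Ω i)ᶜ from h)] at hi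
  exact lt_irrefl _ hi

/-- Along an ultrafilter, corkscrew points at a fixed scale converge to a point of the limit. -/
theorem exists_limit_corkscrew (hM : 0 < M) (hΩ : ∀ i, IsUniformDomain M (Ω i))
    (hΩR : ∀ i, Ω i ⊆ Metric.ball 0 R) (hne : ∀ i, (Ω i)ᶜ.Nonempty) {U : Ultrafilter ℕ}
    (hu : ∀ x, Tendsto (fun i => Metric.infDist x (Ω i)ᶜ) U (𝓝 (u x)))
    {x z : ℕ → EuclideanSpace ℝ (Fin n)} {a : EuclideanSpace ℝ (Fin n)} {r : ℝ} (hr : 0 < r)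
    (hx : ∀ᶠ i in U, x i ∈ Ω i ∧ z i ∈ Ω i ∧ 2 * r ≤ dist (x i) (z i))
    (hxa : Tendsto x U (𝓝 a)) : ∃ y, dist y a = r ∧ 0 < u y := by
  have : ∀ i, ∃ y ∈ Metric.closedBall (0 : EuclideanSpace ℝ (Fin n)) R,
      x i ∈ Ω i ∧ z i ∈ Ω i ∧ 2 * r ≤ dist (x i) (z i) →
        dist y (x i) = r ∧ r / M ≤ Metric.infDist y (Ω i)ᶜ := fun i => by
    by_cases h : x i ∈ Ω i ∧ z i ∈ Ω i ∧ 2 * r ≤ dist (x i) (z i)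
    · obtain ⟨y, hyc, hy⟩ := (hΩ i).exists_corkscrew (hne i) (subset_closure h.1)
        (subset_closure h.2.1) hr.le h.2.2
      exact ⟨y, closure_minimal ((hΩR i).trans Metric.ball_subset_closedBall)
        Metric.isClosed_closedBall hyc, fun _ => hy⟩
    · obtain ⟨w, hw⟩ := (hΩ i).2.1.nonempty
      exact ⟨w, Metric.ball_subset_closedBall (hΩR i hw), fun h' => absurd h' h⟩
  choose y hyK hy using this
  obtain ⟨b, -, hb⟩ := (isCompact_closedBall _ _).exists_tendsto_of_ultrafilter U hyK
  refine ⟨b, ?_, ?_⟩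
  · refine tendsto_nhds_unique (hb.dist hxa) (tendsto_const_nhds.congr' ?_)
    filter_upwards [hx] with i hi using ((hy i hi).1).symm
  · have hlim := tendsto_apply_of_lipschitzWith
      (f := fun i x => Metric.infDist x (Ω i)ᶜ) (fun i => Metric.lipschitz_infDist_pt _) (hu b) hb
    refine lt_of_lt_of_le (div_pos hr hM) (ge_of_tendsto hlim ?_)
    filter_upwards [hx] with i hi using (hy i hi).2

theorem nonempty_limit (hM : 0 < M) (hΩ : ∀ i, IsUniformDomain M (Ω i))
    (hΩR : ∀ i, Ω i ⊆ Metric.ball 0 R) (hne : ∀ i, (Ω i)ᶜ.Nonempty) {δ : ℝ} (hδ : 0 < δ)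
    (hdiam : ∀ i, δ ≤ Metric.diam (Ω i))
    (hu : ∀ x, Tendsto (fun i => Metric.infDist x (Ω i)ᶜ) atTop (𝓝 (u x))) :
    {x | 0 < u x}.Nonempty := by
  choose x hx using fun i => (hΩ i).2.1.nonempty
  -- If all of `Ω i` lay within `δ / 4` of `x i`, its diameter would be at most `δ / 2`.
  have : ∀ i, ∃ z ∈ Ω i, 2 * (δ / 8) ≤ dist (x i) z := fun i => by
    by_contra! h
    have := Metric.diam_le_of_forall_dist_le (C := δ / 2) (by positivity)
      fun a (ha : a ∈ Ω i) b hb => by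
        have := dist_triangle_left a b (x i)
        linarith [h a ha, h b hb]
    linarith [hdiam i]
  choose z hz hxz using this
  obtain ⟨a, -, ha⟩ := (isCompact_closedBall _ _).exists_tendsto_of_ultrafilter (hyperfilter ℕ)
    fun i => Metric.ball_subset_closedBall (hΩR i (hx i))
  obtain ⟨y, -, hy⟩ := exists_limit_corkscrew hM hΩ hΩR hne
    (fun x => (hu x).mono_left Nat.hyperfilter_le_atTop) (by positivity : 0 < δ / 8)
    (Eventually.of_forall fun i => ⟨hx i, hz i, hxz i⟩) ha
  exact ⟨y, hy⟩

theorem mem_closure_limit_of_frequently_mem (hM : 0 < M) (hΩ : ∀ i, IsUniformDomain M (Ω i))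
    (hΩR : ∀ i, Ω i ⊆ Metric.ball 0 R) (hne : ∀ i, (Ω i)ᶜ.Nonempty)
    (hu : ∀ x, Tendsto (fun i => Metric.infDist x (Ω i)ᶜ) atTop (𝓝 (u x)))
    (hnonempty : {x | 0 < u x}.Nonempty) {x : EuclideanSpace ℝ (Fin n)}
    (hx : ∃ᶠ i in atTop, x ∈ Ω i) : x ∈ closure {x | 0 < u x} := by
  by_cases hxu : 0 < u x
  · exact subset_closure hxu
  obtain ⟨z, hz⟩ := hnonempty
  have hxz : 0 < dist x z := dist_pos.2 (by rintro rfl; exact hxu hz)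
  have hNe : (atTop ⊓ 𝓟 {i | x ∈ Ω i}).NeBot := frequently_mem_iff_neBot.1 hx
  -- This ultrafilter lives on the indices with `x ∈ Ω i`, where `x` has corkscrew points towards
  -- `z`.
  let U := Ultrafilter.of (atTop ⊓ 𝓟 {i | x ∈ Ω i})
  have hU : (U : Filter ℕ) ≤ atTop ⊓ 𝓟 {i | x ∈ Ω i} := Ultrafilter.of_le _
  have hUx : ∀ᶠ i in U, x ∈ Ω i := (hU.trans inf_le_right) (mem_principal_self _)
  have hUu := fun x => (hu x).mono_left (hU.trans inf_le_left)
  refine Metric.mem_closure_iff.2 fun ε hε => ?_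
  have hr : 0 < min (ε / 2) (dist x z / 2) := by positivity
  obtain ⟨y, hy, hyu⟩ := exists_limit_corkscrew hM hΩ hΩR hne hUu hr (x := fun _ => x)
    (z := fun _ => z) (a := x) (by
      filter_upwards [hUx, eventually_mem_of_limit_infDist_compl_pos hUu hz] with i h1 h2
      exact ⟨h1, h2, by linarith [min_le_right (ε / 2) (dist x z / 2)]⟩) tendsto_const_nhds
  refine ⟨y, hyu, ?_⟩
  rw [dist_comm, hy]
  linarith [min_le_left (ε / 2) (dist x z / 2)]

theorem exists_approximating_points (hΩ : ∀ i, (Ω i).Nonempty)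
    (hu : ∀ x, Tendsto (fun i => Metric.infDist x (Ω i)ᶜ) atTop (𝓝 (u x)))
    {x : EuclideanSpace ℝ (Fin n)} (hx : x ∈ closure {x | 0 < u x}) :
    ∃ a : ℕ → EuclideanSpace ℝ (Fin n), (∀ i, a i ∈ closure (Ω i)) ∧ Tendsto a atTop (𝓝 x) := by
  choose a ha hax using fun i => Metric.exists_mem_closure_infDist_eq_dist (hΩ i) x
  refine ⟨a, ha, Metric.tendsto_nhds.2 fun ε hε => ?_⟩
  obtain ⟨y, hy, hxy⟩ := Metric.mem_closure_iff.1 hx ε hε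
  filter_upwards [eventually_mem_of_limit_infDist_compl_pos hu hy] with i hi
  rw [dist_comm, ← hax]
  exact (Metric.infDist_le_dist_of_mem hi).trans_lt hxy

theorem isOpen_limit (hu : ∀ x, Tendsto (fun i => Metric.infDist x (Ω i)ᶜ) atTop (𝓝 (u x))) :
    IsOpen {x | 0 < u x} := by
  have hL : LipschitzWith 1 u := LipschitzWith.of_dist_le_mul fun x y =>
    le_of_tendsto ((hu x).dist (hu y)) (Eventually.of_forall fun i =>
      (Metric.lipschitz_infDist_pt (Ω i)ᶜ).dist_le_mul x y)
  exact isOpen_lt continuous_const hL.continuous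

theorem exists_limit_path (hM : 0 < M) (hΩ : ∀ i, IsUniformDomain M (Ω i))
    (hΩR : ∀ i, Ω i ⊆ Metric.ball 0 R) (hne : ∀ i, (Ω i)ᶜ.Nonempty)
    (hu : ∀ x, Tendsto (fun i => Metric.infDist x (Ω i)ᶜ) atTop (𝓝 (u x)))
    {x y : EuclideanSpace ℝ (Fin n)} (hx : x ∈ closure {x | 0 < u x})
    (hy : y ∈ closure {x | 0 < u x}) :
    ∃ p : Path x y, BoundedVariationOn p Set.univ ∧
      Measure.hausdorffMeasure 1 (Set.range p) ≤ ENNReal.ofReal (M * dist x y) ∧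
      ∀ t, 1 / M * min (dist (p t) x) (dist (p t) y) ≤ u (p t) := by
  obtain ⟨a, ha, hax⟩ := exists_approximating_points (fun i => (hΩ i).2.1.nonempty) hu hx
  obtain ⟨b, hb, hby⟩ := exists_approximating_points (fun i => (hΩ i).2.1.nonempty) hu hy
  choose γ hγc _ hγH hγd using fun i => (hΩ i).2.2 (a i) (ha i) (b i) (hb i)
  let ε : ℕ → ℝ := fun i => 1 / ((i : ℝ) + 1)
  have hε : ∀ i, 0 < ε i := fun i => by positivity
  choose g hg0 hg1 hgγ hg using fun i => exists_step_map_of_hausdorffMeasure_le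
    (isPreconnected_range (γ i).continuous) (by positivity) (hγH i)
    ⟨0, (γ i).source⟩ ⟨1, (γ i).target⟩ (hε i)
  let U := hyperfilter ℕ
  have hU : (U : Filter ℕ) ≤ atTop := Nat.hyperfilter_le_atTop
  have hε0 : Tendsto ε U (𝓝 0) := tendsto_one_div_add_atTop_nhds_zero_nat.mono_left hU
  have hax' := hax.mono_left hU
  have hby' := hby.mono_left hU
  have hgc : ∀ i t, g i t ∈ closure (Ω i) := fun i t => by
    obtain ⟨s, hs⟩ := hgγ i t
    rw [← hs]; exact hγc i s
  have hgd : ∀ i t, 1 / M * min (dist (g i t) (a i)) (dist (g i t) (b i)) ≤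
      Metric.infDist (g i t) (Ω i)ᶜ := fun i t => by
    obtain ⟨s, hs⟩ := hgγ i t
    rw [← hs]
    exact le_infDist_compl_of_le_infEDist_frontier (hΩ i).1 (hne i) (hγc i s) (hγd i s)
  have hT : Tendsto (fun i => M * dist (a i) (b i) + ε i) U (𝓝 (M * dist x y)) := by
    simpa using ((hax'.dist hby').const_mul M).add hε0
  obtain ⟨c, hcL, hc⟩ := exists_lipschitzOnWith_ultrafilter_limit (isCompact_closedBall 0 R) U
    (fun i t => closure_minimal ((hΩR i).trans Metric.ball_subset_closedBall)
        Metric.isClosed_closedBall (hgc i t)) hT hε0 hg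
  obtain ⟨p, hp, hpv, hpH⟩ := exists_path_of_lipschitzOnWith hcL
    (tendsto_nhds_unique (hc 0) (by simpa only [hg0] using hax'))
    (tendsto_nhds_unique (hc 1) (by simpa only [hg1] using hby'))
  refine ⟨p, hpv, hpH, fun t => ?_⟩
  rw [hp]
  exact le_of_tendsto_of_tendsto
    ((((hc t).dist hax').min ((hc t).dist hby')).const_mul (1 / M))
    (tendsto_apply_of_lipschitzWith (f := fun i x => Metric.infDist x (Ω i)ᶜ)
      (fun i => Metric.lipschitz_infDist_pt _) ((hu _).mono_left hU) (hc t))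
    (Eventually.of_forall fun i => hgd i t)

theorem isUniformDomain_limit (hM : 0 < M) (hΩ : ∀ i, IsUniformDomain M (Ω i))
    (hΩR : ∀ i, Ω i ⊆ Metric.ball 0 R) (hne : ∀ i, (Ω i)ᶜ.Nonempty)
    (hu : ∀ x, Tendsto (fun i => Metric.infDist x (Ω i)ᶜ) atTop (𝓝 (u x)))
    (hnonempty : {x | 0 < u x}.Nonempty) : IsUniformDomain M {x | 0 < u x} := by
  have hopen := isOpen_limit hu
  -- The cigar condition alone keeps the path in the limit set away from its endpoints.
  have hmem : ∀ {x y : EuclideanSpace ℝ (Fin n)} (p : Path x y),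
      (∀ t, 1 / M * min (dist (p t) x) (dist (p t) y) ≤ u (p t)) →
      ∀ t, p t ≠ x → p t ≠ y → 0 < u (p t) := fun {x y} p hp t hx hy =>
    lt_of_lt_of_le (mul_pos (by positivity) (lt_min (dist_pos.2 hx) (dist_pos.2 hy))) (hp t)
  refine ⟨hopen, IsPathConnected.isConnected ?_, fun x hx y hy => ?_⟩
  · rw [isPathConnected_iff]
    refine ⟨hnonempty, fun x hx y hy => ?_⟩
    obtain ⟨p, -, -, hp⟩ := exists_limit_path hM hΩ hΩR hne hu (subset_closure hx)
      (subset_closure hy)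
    refine ⟨p, fun t => ?_⟩
    by_cases h1 : p t = x
    · rwa [h1]
    by_cases h2 : p t = y
    · rwa [h2]
    exact hmem p hp t h1 h2
  · obtain ⟨p, hpv, hpH, hp⟩ := exists_limit_path hM hΩ hΩR hne hu hx hy
    refine ⟨p, fun t => ?_, hpv, hpH, fun t => ?_⟩
    · by_cases h1 : p t = x
      · rwa [h1]
      by_cases h2 : p t = y
      · rwa [h2]
      exact subset_closure (hmem p hp t h1 h2)
    · refine (ENNReal.ofReal_le_ofReal (hp t)).trans (Metric.le_infEDist.2 fun z hz => ?_)
      rw [edist_dist]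
      refine ENNReal.ofReal_le_ofReal ?_
      have hz0 : u z ≤ 0 := by
        rw [hopen.frontier_eq] at hz
        exact not_lt.1 hz.2
      -- As `u ≤ 0` on the frontier and `u` is 1-Lipschitz, `u` bounds the distance to the frontier
      -- from below.
      have h1 : u (p t) ≤ u z + dist (p t) z := le_of_tendsto_of_tendsto (hu (p t))
        ((hu z).add_const _) (Eventually.of_forall fun i => Metric.infDist_le_infDist_add_dist)
      linarith

end Limit

/-! ### L¹ convergence and conclusion -/

theorem tendstoL1_of_ae_eventually {n : ℕ} {R : ℝ} {A : ℕ → Set (EuclideanSpace ℝ (Fin n))}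
    {B : Set (EuclideanSpace ℝ (Fin n))} (hA : ∀ k, MeasurableSet (A k)) (hB : MeasurableSet B)
    (hAR : ∀ k, A k ⊆ Metric.ball 0 R) (hBR : B ⊆ Metric.ball 0 R)
    (h : ∀ᵐ x, ∀ᶠ k in atTop, (x ∈ A k ↔ x ∈ B)) : TendstoL1 A B := by
  unfold TendstoL1
  simp only [eLpNorm_one_eq_lintegral_enorm]
  rw [← lintegral_zero (μ := (volume : Measure (EuclideanSpace ℝ (Fin n))))]
  refine tendsto_lintegral_of_dominated_convergence
    ((Metric.ball (0 : EuclideanSpace ℝ (Fin n)) R).indicator fun _ => 1) ?_ ?_ ?_ ?_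
  · intro k
    exact ((measurable_const.indicator (hA k)).sub (measurable_const.indicator hB)).enorm
  · refine fun k => Eventually.of_forall fun x => ?_
    by_cases hx : x ∈ Metric.ball (0 : EuclideanSpace ℝ (Fin n)) R
    · by_cases h1 : x ∈ A k <;> by_cases h2 : x ∈ B <;> simp [h1, h2, hx, -Metric.mem_ball]
    · have h1 : x ∉ A k := fun h => hx (hAR k h)
      have h2 : x ∉ B := fun h => hx (hBR h)
      simp [h1, h2]
  · rw [lintegral_indicator Metric.isOpen_ball.measurableSet]
    simpa using measure_ball_lt_top.ne
  · filter_upwards [h] with x hx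
    refine tendsto_const_nhds.congr' ?_
    filter_upwards [hx] with k hk
    by_cases h2 : x ∈ B
    · simp [h2, hk.2 h2]
    · simp [h2, mt hk.1 h2]

theorem theorem1p1 (n : ℕ) (M R : ℝ) (hM : 0 < M)
    (Ω : ℕ → Set (EuclideanSpace ℝ (Fin n)))
    (hΩ : ∀ i, IsUniformDomain M (Ω i))
    (hΩR : ∀ i, Ω i ⊆ Metric.ball 0 R)
    (hdiam : 0 < ⨅ i, Metric.diam (Ω i)) :
    ∃ (Ω' : Set (EuclideanSpace ℝ (Fin n))) (φ : ℕ → ℕ),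
      IsUniformDomain M Ω' ∧ Ω' ⊆ Metric.ball 0 R ∧
      StrictMono φ ∧ TendstoL1 (fun k => Ω (φ k)) Ω' := by
  have hδ : ∀ i, ⨅ j, Metric.diam (Ω j) ≤ Metric.diam (Ω i) := fun i =>
    ciInf_le ⟨0, by rintro _ ⟨j, rfl⟩; exact Metric.diam_nonneg⟩ i
  -- In dimension zero all diameters vanish.
  have hnt : Nontrivial (EuclideanSpace ℝ (Fin n)) := by
    by_contra h
    rw [not_nontrivial_iff_subsingleton] at h
    refine absurd (hδ 0) (not_le.2 ?_)
    rwa [Metric.diam_subsingleton Set.subsingleton_of_subsingleton]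
  -- A common point of all complements bounds the distance functions uniformly in `i`.
  obtain ⟨q, hq⟩ := NormedSpace.exists_lt_norm ℝ (EuclideanSpace ℝ (Fin n)) R
  have hqΩ : ∀ i, q ∈ (Ω i)ᶜ := fun i h => by
    have := hΩR i h
    rw [mem_ball_zero_iff] at this
    exact lt_asymm hq this
  obtain ⟨φ, u, hφ, hu⟩ := exists_subseq_tendsto_of_lipschitz
    (f := fun i x => Metric.infDist x (Ω i)ᶜ) (fun i => Metric.lipschitz_infDist_pt _)
    (a := fun _ => 0) (b := fun x => dist x q)
    fun i x => ⟨Metric.infDist_nonneg, Metric.infDist_le_dist_of_mem (hqΩ i)⟩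
  have hne : ∀ k, (Ω (φ k))ᶜ.Nonempty := fun k => ⟨q, hqΩ _⟩
  have hnonempty := nonempty_limit hM (fun k => hΩ (φ k)) (fun k => hΩR (φ k)) hne hdiam
    (fun k => hδ (φ k)) hu
  have hunif := isUniformDomain_limit hM (fun k => hΩ (φ k)) (fun k => hΩR (φ k)) hne hu hnonempty
  have hsub : {x | 0 < u x} ⊆ Metric.ball 0 R := fun x hx => by
    obtain ⟨k, hk⟩ := (eventually_mem_of_limit_infDist_compl_pos hu hx).exists
    exact hΩR _ hk
  refine ⟨{x | 0 < u x}, φ, hunif, hsub, hφ, ?_⟩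
  refine tendstoL1_of_ae_eventually (fun k => (hΩ (φ k)).1.measurableSet) hunif.1.measurableSet
    (fun k => hΩR (φ k)) hsub ?_
  have hnull := hunif.volume_frontier hM ⟨q, fun h => by
    have := hsub h
    rw [mem_ball_zero_iff] at this
    exact lt_asymm hq this⟩
  filter_upwards [measure_eq_zero_iff_ae_notMem.1 hnull] with x hx
  by_cases hxu : 0 < u x
  · filter_upwards [eventually_mem_of_limit_infDist_compl_pos hu hxu] with k hk
    exact iff_of_true hk hxu
  · have : ¬ ∃ᶠ k in atTop, x ∈ Ω (φ k) := fun h => hx (by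
      rw [hunif.1.frontier_eq]
      exact ⟨mem_closure_limit_of_frequently_mem hM (fun k => hΩ (φ k)) (fun k => hΩR (φ k)) hne hu
        hnonempty h, hxu⟩)
    filter_upwards [not_frequently.1 this] with k hk
    exact iff_of_false hk hxu
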